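/- Let $N\ge 0$ be an integer and let $M$ be either $\mathbb R^N$ or the flat torus $\mathbb T^N=\mathbb R^N/\mathbb Z^N$. Let $H:M\times\mathbb R^N\to\mathbb R$ be a strictly convex Hamiltonian, i.e. $H$ is continuous, $p\mapsto H(x,p)$ is strictly convex on $\mathbb R^N$ for every $x\in M$, and there are functions $\alpha,\beta:[0,+\infty)\to\mathbb R$ with $\alpha(h)/h\to+\infty$ and $\beta(h)/h\to+\infty$ as $h\to+\infty$ such that $\alpha(|p|)\le H(x,p)\le\beta(|p|)$ for all $(x,p)\in M\times\mathbb R^N$. Let $L(x,q)=\sup_{p\in\mathbb R^N}\{\langle p,q\rangle-H(x,p)\}$ be the associated Lagrangian. A subsolution of $H(x,Du)=a$ in $M$ is a continuous function $u:M\to\mathbb R$ such that $H(x,D\varphi(x))\le a$ whenever $x\in M$ and $\varphi\in C^1(M)$ satisfies $\varphi\ge u$ on $M$ and $\varphi(x)=u(x)$. The critical value of $H$ is the least $a\in\mathbb R$ for which $H(x,Du)=a$ admits a subsolution; assume, as one may after adding a constant to $H$, that it is $0$, and call critical subsolutions the subsolutions of $H(x,Du)=0$. For $x,y\in M$ set $$S(x,y)=\inf\Big\{\int_0^1\sigma(\gamma(s),\dot\gamma(s))\,ds\;:\;\gamma:[0,1]\to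 M\text{ Lipschitz},\ \gamma(0)=x,\ \gamma(1)=y\Big\},\qquad \sigma(x,q)=\sup\{\langle q,p\rangle : H(x,p)\le 0\}.$$ A static curve defined on $\mathbb R$ is a map $\gamma:\mathbb R\to M$, absolutely continuous on every compact interval, such that for all $t_1<t_2$ $$S(\gamma(t_1),\gamma(t_2))=\int_{t_1}^{t_2}L(\gamma,\dot\gamma)\,ds=-S(\gamma(t_2),\gamma(t_1)).$$ For such a $\gamma$, let $\Sigma_\gamma\subset\mathbb R$ be the complement of the set of all $t\in\mathbb R$ at which $\gamma$ is differentiable and which are Lebesgue points of $s\mapsto D_qL(\gamma(s),\dot\gamma(s))$. **Theorem.** Let $\gamma$ be a static curve defined on $\mathbb R$. Then $\Sigma_\gamma$ has Lebesgue measure zero and, for every critical subsolution $u$ and every $t_0\in\mathbb R\setminus\Sigma_\gamma$, the function $q\mapsto L(\gamma(t_0),q)$ is differentiable at $\dot\gamma(t_0)$, the function $u$ is differentiable at $\gamma(t_0)$, and $$Du(\gamma(t_0))=D_qL(\gamma(t_0),\dot\gamma(t_0)).$$ -/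

import Mathlib

open Set Filter Topology MeasureTheory

noncomputable section

/-- `ℝ^N` with its Euclidean norm and scalar product. -/
abbrev Vec (N : ℕ) : Type := EuclideanSpace ℝ (Fin N)

/-- The lattice `ℤ^N` in `ℝ^N`. -/
def integerLattice (N : ℕ) : AddSubgroup (Vec N) where
  carrier := {x | ∀ i, ∃ k : ℤ, x i = k}
  zero_mem' := fun _ => ⟨0, by simp⟩
  add_mem' := by
    intro x y hx hy i
    obtain ⟨k, hk⟩ := hx i
    obtain ⟨l, hl⟩ := hy i
    exact ⟨k + l, by simp [hk, hl]⟩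
  neg_mem' := by
    intro x hx i
    obtain ⟨k, hk⟩ := hx i
    exact ⟨-k, by simp [hk]⟩

/-- The space `M = ℝ^N / Γ`, with the quotient norm `|x| = inf_{k ∈ Γ} |x + k|`.
It is `ℝ^N` for `Γ = 0` and the flat torus `𝕋^N` for `Γ = ℤ^N`. -/
abbrev FlatSpace (N : ℕ) (Γ : AddSubgroup (Vec N)) : Type := Vec N ⧸ Γ

variable {N : ℕ} {Γ : AddSubgroup (Vec N)}

/-- The projection `ℝ^N → M`. -/
def proj (Γ : AddSubgroup (Vec N)) (v : Vec N) : FlatSpace N Γ := QuotientAddGroup.mk v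

/-! ### Differential calculus on `M` -/

/-- `u : M → ℝ` is differentiable at `x` with gradient `p`. -/
def HasGradAt (u : FlatSpace N Γ → ℝ) (p : Vec N) (x : FlatSpace N Γ) : Prop :=
  HasGradientAt (fun v : Vec N => u (x + proj Γ v)) p 0

/-- `φ ∈ C¹(M)`. -/
def IsC1 (φ : FlatSpace N Γ → ℝ) : Prop :=
  ContDiff ℝ 1 (fun v : Vec N => φ (proj Γ v))

/-- The set `D⁺u(x)` of superdifferentials of `u` at `x`: the gradients at `x` of the `C¹`
functions that touch `u` from above at `x`. -/
def superdifferential (u : FlatSpace N Γ → ℝ) (x : FlatSpace N Γ) : Set (Vec N) :=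
  {p | ∃ φ : FlatSpace N Γ → ℝ, IsC1 φ ∧ φ x = u x ∧ (∀ y, u y ≤ φ y) ∧ HasGradAt φ p x}

/-- The curve `γ` in `M` is differentiable at `t` with derivative `v`, read in a local lift of
`γ` to `ℝ^N`. -/
def HasVelocityAt (γ : ℝ → FlatSpace N Γ) (v : Vec N) (t : ℝ) : Prop :=
  ∃ c : ℝ → Vec N, (∀ᶠ s in 𝓝 t, proj Γ (c s) = γ s) ∧ HasDerivAt c v t

open Classical in
/-- The derivative `γ̇(t)` (and `0` where `γ` is not differentiable). -/
def velocity (γ : ℝ → FlatSpace N Γ) (t : ℝ) : Vec N :=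
  if h : ∃ v, HasVelocityAt γ v t then h.choose else 0

/-! ### Hamiltonian and Lagrangian -/

/-- `g(h) / h → +∞` as `h → +∞`. -/
def Superlinear (g : ℝ → ℝ) : Prop :=
  Tendsto (fun h => g h / h) atTop atTop

/-- Strictly convex Hamiltonians on `M × ℝ^N`: continuous, strictly convex in the momentum, and
bounded below and above by superlinear functions of `|p|`. -/
structure IsStrictlyConvexHamiltonian (H : FlatSpace N Γ → Vec N → ℝ) : Prop where
  continuous : Continuous (fun z : FlatSpace N Γ × Vec N => H z.1 z.2)
  strictConvex : ∀ x, StrictConvexOn ℝ univ (H x)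
  superlinear : ∃ α β : ℝ → ℝ, Superlinear α ∧ Superlinear β ∧
    ∀ x p, α ‖p‖ ≤ H x p ∧ H x p ≤ β ‖p‖

/-- The Lagrangian `L(x,q) = sup_p (⟨p, q⟩ - H(x,p))`. -/
def lagrangian (H : FlatSpace N Γ → Vec N → ℝ) (x : FlatSpace N Γ) (q : Vec N) : ℝ :=
  ⨆ p : Vec N, (inner ℝ p q - H x p)

/-- The partial derivative `D_q L(x,q)`. -/
def lagrangianGrad (H : FlatSpace N Γ → Vec N → ℝ) (x : FlatSpace N Γ) (q : Vec N) : Vec N :=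
  gradient (lagrangian H x) q

/-! ### Subsolutions, critical value, semidistances -/

/-- `u` is a (continuous) viscosity subsolution of `H(x, Du) = a` in `M`. -/
def IsSubsolution (H : FlatSpace N Γ → Vec N → ℝ) (a : ℝ) (u : FlatSpace N Γ → ℝ) : Prop :=
  Continuous u ∧ ∀ x, ∀ p ∈ superdifferential u x, H x p ≤ a

/-- `c` is the critical value of `H`: the least `a` such that `H(x, Du) = a` admits
subsolutions. -/
def IsCriticalValue (H : FlatSpace N Γ → Vec N → ℝ) (c : ℝ) : Prop :=
  IsLeast {a : ℝ | ∃ u, IsSubsolution H a u} c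

/-- The support function `σ_a(x,q)` of the sublevel `Z_a(x) = {p : H(x,p) ≤ a}`. -/
def supportFun (H : FlatSpace N Γ → Vec N → ℝ) (a : ℝ) (x : FlatSpace N Γ) (q : Vec N) : ℝ :=
  sSup {r : ℝ | ∃ p : Vec N, H x p ≤ a ∧ r = inner ℝ q p}

/-- The semidistance `S_a(x,y)`: the infimum of `∫_0^1 σ_a(γ, γ̇) ds` over the
Lipschitz curves `γ : [0,1] → M` from `x` to `y`. -/
def semidistance (H : FlatSpace N Γ → Vec N → ℝ) (a : ℝ) (x y : FlatSpace N Γ) : ℝ :=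
  sInf {r : ℝ | ∃ γ : ℝ → FlatSpace N Γ, (∃ K, LipschitzOnWith K γ (Icc 0 1)) ∧
    γ 0 = x ∧ γ 1 = y ∧ r = ∫ s in (0 : ℝ)..1, supportFun H a (γ s) (velocity γ s)}

/-! ### Static curves -/

/-- `γ` is a static curve defined on `ℝ`, for a Hamiltonian `H` whose critical value is `0`. -/
def IsStaticCurve (H : FlatSpace N Γ → Vec N → ℝ) (γ : ℝ → FlatSpace N Γ) : Prop :=
  (∀ a b : ℝ, AbsolutelyContinuousOnInterval γ a b) ∧
  ∀ t₁ t₂ : ℝ, t₁ < t₂ →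
    IntervalIntegrable (fun s => lagrangian H (γ s) (velocity γ s)) volume t₁ t₂ ∧
    semidistance H 0 (γ t₁) (γ t₂) = ∫ s in t₁..t₂, lagrangian H (γ s) (velocity γ s) ∧
    ∫ s in t₁..t₂, lagrangian H (γ s) (velocity γ s) = -semidistance H 0 (γ t₂) (γ t₁)

/-- `t` is a Lebesgue point of `f`: `f` is integrable near `t` and the mean value of
`|f - f(t)|` over `[t - r, t + r]` tends to `0` as `r → 0⁺`. -/
def IsLebesguePoint (f : ℝ → Vec N) (t : ℝ) : Prop :=
  IntegrableAtFilter f (𝓝 t) volume ∧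
  Tendsto (fun r : ℝ => (2 * r)⁻¹ * ∫ s in (t - r)..(t + r), ‖f s - f t‖) (𝓝[>] 0) (𝓝 0)

/-- The set `Σ_γ`: the complement of the set of differentiability points of `γ` that are
Lebesgue points of `s ↦ D_q L(γ(s), γ̇(s))`. -/
def exceptionalSet (H : FlatSpace N Γ → Vec N → ℝ) (γ : ℝ → FlatSpace N Γ) : Set ℝ :=
  {t | (∃ v, HasVelocityAt γ v t) ∧
    IsLebesguePoint (fun s => lagrangianGrad H (γ s) (velocity γ s)) t}ᶜ

end

/-!
The whole argument is carried out on `ℝ^N`: the projection onto `M` is a covering map and a local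
isometry, so absolutely continuous curves lift (`IsSeparated.exists_lift`,
`IsSeparated.absolutelyContinuousOnInterval_lift`), and the velocity is the derivative of any lift.

A critical subsolution `u` need not be differentiable at any point of a general curve, and no
mollification is used. Instead, a doubling argument shows that `u` grows by at most `m` under a
translation by `q` as soon as `⟨p, q⟩ ≤ m` for all `p` in the nearby zero sublevels of `H`
(`IsSubsolution.sub_le_of_inner_le`). It follows that `u` is Lipschitz, that no zero sublevel is
empty, and that the derivative of `u` along a curve, where it exists, is at most the support
function `σ` of the zero sublevel at the velocity. Integrating, `u(y) - u(x) ≤ S(x, y)`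
(`IsSubsolution.sub_le_semidistance`).

Between two points of a static curve `γ` the distance `S` in one direction is the opposite of the
distance in the other one, so that the increment of `u` along `γ` equals the action
(`IsStaticCurve.isCalibrated`). Since `σ ≤ L`, this forces `σ = L` almost everywhere along `γ`; as
`σ` has linear and `L` superlinear growth in the velocity, `γ` is Lipschitz. Hence `D_q L(γ, γ̇)` is
bounded and measurable, and almost every time is one of its Lebesgue points.

At such a time `t`, write a small vector as `h v` with `|v| = δ` fixed and compare `γ` with the
curves that leave it at time `t - h` to reach `γ(t) + h v` at time `t`, or start there at time `t`
and rejoin `γ` at time `t + h`, drifting relative to it with constant velocity `±v`. The bound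
`u(ξ(b)) - u(ξ(a)) ≤ ∫ L(ξ, ξ̇)` for these competitors and convexity of `L` in the velocity give
one-sided bounds of `u(γ(t) + h v) - u(γ(t))` by `⟨∫ D_q L(γ, γ̇), v⟩`, the integral being over
`[t - h, t]` or `[t, t + h]`, up to an error `2 ε h δ` controlled by the moduli of continuity of
`L` and `D_q L`. At a Lebesgue point the mean value of `D_q L(γ, γ̇)` may be replaced by its value at
`t`, which makes it the gradient of `u` (`IsCalibrated.hasGradAt`).
-/

/-! ### The lattice and its covering map -/

/-- Nonzero elements of `Γ` have norm at least `r`: the encoding of the discreteness of `Γ` used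
below. -/
def IsSeparated {N : ℕ} (Γ : AddSubgroup (Vec N)) (r : ℝ) : Prop :=
  0 < r ∧ ∀ k ∈ Γ, ‖k‖ < r → k = 0

lemma isSeparated_bot {N : ℕ} : IsSeparated (⊥ : AddSubgroup (Vec N)) 1 :=
  ⟨one_pos, fun _ hk _ => hk⟩

lemma isSeparated_integerLattice {N : ℕ} : IsSeparated (integerLattice N) 1 := by
  refine ⟨one_pos, fun k hk hk1 => ?_⟩
  ext i
  obtain ⟨n, hn⟩ := hk i
  have h1 : |(n : ℝ)| < 1 := by
    rw [← hn, ← Real.norm_eq_abs]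
    exact (PiLp.norm_apply_le k i).trans_lt hk1
  have h2 : n = 0 := by
    have : |n| < 1 := by exact_mod_cast h1
    exact Int.abs_lt_one_iff.1 this
  simp [hn, h2]

section Covering

variable {N : ℕ} {Γ : AddSubgroup (Vec N)} {r : ℝ}

lemma continuous_proj : Continuous (proj Γ) := continuous_quot_mk

lemma proj_add (v w : Vec N) : proj Γ (v + w) = proj Γ v + proj Γ w := rfl

lemma proj_sub (v w : Vec N) : proj Γ (v - w) = proj Γ v - proj Γ w := rfl

lemma proj_eq_proj {v w : Vec N} : proj Γ v = proj Γ w ↔ w - v ∈ Γ := by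
  rw [proj, proj, QuotientAddGroup.eq, neg_add_eq_sub]

lemma norm_proj_le (v : Vec N) : ‖proj Γ v‖ ≤ ‖v‖ := QuotientAddGroup.norm_mk_le_norm

lemma proj_surjective : Function.Surjective (proj Γ) := Quotient.mk_surjective

namespace IsSeparated

lemma isDiscrete (hr : IsSeparated Γ r) : IsDiscrete (Γ : Set (Vec N)) := by
  refine ⟨discreteTopology_iff_isOpen_singleton.2 fun a => ?_⟩
  rw [Metric.isOpen_singleton_iff]
  refine ⟨r, hr.1, fun b hb => ?_⟩
  rw [Subtype.dist_eq, dist_eq_norm] at hb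
  exact Subtype.ext (sub_eq_zero.1 (hr.2 _ (Γ.sub_mem b.2 a.2) hb))

lemma isCoveringMap (hr : IsSeparated Γ r) : IsCoveringMap (proj Γ) :=
  (AddSubgroup.isAddQuotientCoveringMap_of_comm Γ hr.isDiscrete).isCoveringMap

/-- The projection is a local isometry. -/
lemma norm_proj (hr : IsSeparated Γ r) {w : Vec N} (hw : ‖w‖ < r / 2) : ‖proj Γ w‖ = ‖w‖ := by
  refine le_antisymm (norm_proj_le w) (le_of_forall_pos_lt_add fun ε hε => ?_)
  obtain ⟨m, hm, hm'⟩ := QuotientAddGroup.exists_norm_mk_lt (proj Γ w)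
    (lt_min hε (sub_pos.2 hw))
  have h1 : w - m ∈ Γ := proj_eq_proj.1 hm
  have h2 : ‖w - m‖ < r := by
    have := norm_sub_le w m
    have := norm_proj_le (Γ := Γ) w
    have := min_le_right ε (r / 2 - ‖w‖)
    linarith
  have h3 : w = m := sub_eq_zero.1 (hr.2 _ h1 h2)
  have := min_le_left ε (r / 2 - ‖w‖)
  rw [← h3] at hm'
  linarith

lemma exists_lift (hr : IsSeparated Γ r) {γ : ℝ → FlatSpace N Γ} (hγ : Continuous γ) :
    ∃ c : ℝ → Vec N, Continuous c ∧ ∀ t, proj Γ (c t) = γ t := by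
  obtain ⟨e, he⟩ := proj_surjective (γ 0)
  obtain ⟨F, ⟨-, hF⟩, -⟩ :=
    hr.isCoveringMap.existsUnique_continuousMap_lifts ⟨γ, hγ⟩ 0 e he
  exact ⟨F, F.continuous, fun t => congrFun hF t⟩

/-- On short intervals, as uniform continuity of the lift allows, the lift and the curve have the
same increments, and absolute continuity concerns only short intervals. -/
lemma absolutelyContinuousOnInterval_lift (hr : IsSeparated Γ r) {γ : ℝ → FlatSpace N Γ}
    {c : ℝ → Vec N} {a b : ℝ} (hc : ContinuousOn c (uIcc a b))
    (hcγ : ∀ t ∈ uIcc a b, proj Γ (c t) = γ t)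
    (hγ : AbsolutelyContinuousOnInterval γ a b) : AbsolutelyContinuousOnInterval c a b := by
  rw [absolutelyContinuousOnInterval_iff] at hγ ⊢
  intro ε hε
  obtain ⟨δ, hδ, h⟩ := hγ ε hε
  obtain ⟨η, hη, hη'⟩ := Metric.uniformContinuousOn_iff.1
    (isCompact_uIcc.uniformContinuousOn_of_continuous hc) (r / 2) (half_pos hr.1)
  refine ⟨min δ η, lt_min hδ hη, fun E hE hlt => ?_⟩
  refine lt_of_eq_of_lt (Finset.sum_congr rfl fun i hi => ?_)
    (h E hE (hlt.trans_le (min_le_left _ _)))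
  have h1 : dist (E.2 i).1 (E.2 i).2 < η :=
    (Finset.single_le_sum (f := fun i => dist (E.2 i).1 (E.2 i).2)
      (fun _ _ => dist_nonneg) hi).trans_lt (hlt.trans_le (min_le_right _ _))
  have h2 := hη' _ (hE.1 i hi).1 _ (hE.1 i hi).2 h1
  rw [← hcγ _ (hE.1 i hi).1, ← hcγ _ (hE.1 i hi).2, dist_eq_norm, dist_eq_norm, ← proj_sub,
    hr.norm_proj (by rwa [← dist_eq_norm])]

lemma hasVelocityAt_iff (hr : IsSeparated Γ r) {γ : ℝ → FlatSpace N Γ} {c : ℝ → Vec N} {t : ℝ}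
    (hc : ContinuousAt c t) (hcγ : ∀ᶠ s in 𝓝 t, proj Γ (c s) = γ s) {v : Vec N} :
    HasVelocityAt γ v t ↔ HasDerivAt c v t := by
  refine ⟨fun ⟨c', hc', hv⟩ => ?_, fun h => ⟨c, hcγ, h⟩⟩
  have h1 : Tendsto (fun s => (c' s - c s) - (c' t - c t)) (𝓝 t) (𝓝 0) := by
    have := (hv.continuousAt.sub hc).sub (continuousAt_const (y := c' t - c t))
    simpa only [ContinuousAt, Pi.sub_apply, sub_self] using! this
  have h2 : ∀ᶠ s in 𝓝 t, ‖(c' s - c s) - (c' t - c t)‖ < r :=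
    (tendsto_zero_iff_norm_tendsto_zero.1 h1).eventually (gt_mem_nhds hr.1)
  have hmem : ∀ᶠ s in 𝓝 t, c' s - c s ∈ Γ := by
    filter_upwards [hc', hcγ] with s h3 h4
    exact proj_eq_proj.1 (h4.trans h3.symm)
  have h3 : c =ᶠ[𝓝 t] fun s => c' s - (c' t - c t) := by
    filter_upwards [h2, hmem] with s h4 h5
    have := sub_eq_zero.1 (hr.2 _ (Γ.sub_mem h5 hmem.self_of_nhds) h4)
    rw [← this]; abel
  exact (hv.sub_const _).congr_of_eventuallyEq h3

/-- The velocity of a curve is the derivative of any of its continuous lifts; the two agree also at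
points without a derivative, where both are `0`. -/
lemma velocity_eq_deriv (hr : IsSeparated Γ r) {γ : ℝ → FlatSpace N Γ} {c : ℝ → Vec N} {t : ℝ}
    (hc : ContinuousAt c t) (hcγ : ∀ᶠ s in 𝓝 t, proj Γ (c s) = γ s) :
    velocity γ t = deriv c t := by
  unfold velocity
  split_ifs with h
  · exact ((hr.hasVelocityAt_iff hc hcγ).1 h.choose_spec).deriv.symm
  · refine (deriv_zero_of_not_differentiableAt fun hd => h ⟨deriv c t, ?_⟩).symm
    exact (hr.hasVelocityAt_iff hc hcγ).2 hd.hasDerivAt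

end IsSeparated

end Covering

/-! ### Test functions -/

section TestFunctions

variable {N : ℕ} {Γ : AddSubgroup (Vec N)} {r : ℝ}

open scoped ContDiff Manifold

/-- Every continuous function on `M` lies below a `C¹` function. -/
def HasC1Majorants (Γ : AddSubgroup (Vec N)) : Prop :=
  ∀ u : FlatSpace N Γ → ℝ, Continuous u → ∃ B : FlatSpace N Γ → ℝ, IsC1 B ∧ ∀ y, u y ≤ B y

/-- On `ℝ^N` a majorant is glued from local constants by a partition of unity. -/
lemma hasC1Majorants_bot : HasC1Majorants (⊥ : AddSubgroup (Vec N)) := by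
  intro u hu
  obtain ⟨g, hg⟩ := exists_contMDiffMap_forall_mem_convex_of_local_const (n := 1) 𝓘(ℝ, Vec N)
    (t := fun v : Vec N => Ici (u (proj ⊥ v))) (fun _ => convex_Ici _) (fun v =>
      ⟨u (proj ⊥ v) + 1, ((hu.comp continuous_proj).continuousAt.eventually
        (gt_mem_nhds (lt_add_one _))).mono fun y hy => hy.le⟩)
  have hout : ∀ v : Vec N, (Quotient.out (proj ⊥ v) : Vec N) = v := fun v => by
    have : proj ⊥ (Quotient.out (proj ⊥ v) : Vec N) = proj ⊥ v := Quotient.out_eq _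
    exact (sub_eq_zero.1 (AddSubgroup.mem_bot.1 (proj_eq_proj.1 this))).symm
  refine ⟨fun y => g (Quotient.out y), ?_, fun y => ?_⟩
  · simp only [IsC1, hout]
    exact g.contMDiff.contDiff
  · obtain ⟨v, rfl⟩ := proj_surjective y
    simpa [hout] using hg v

/-- On the torus a constant suffices: `u` is bounded, as every orbit of the lattice meets the closed
ball of radius `√N`. -/
lemma hasC1Majorants_integerLattice : HasC1Majorants (integerLattice N) := by
  intro u hu
  obtain ⟨C, hC⟩ := ((isCompact_closedBall (0 : Vec N) (√N)).image
    (hu.comp continuous_proj)).bddAbove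
  refine ⟨fun _ => C, contDiff_const, fun y => ?_⟩
  obtain ⟨v, rfl⟩ := proj_surjective y
  have h : proj (integerLattice N) v =
      proj (integerLattice N) (WithLp.toLp 2 fun i => Int.fract (v i)) := by
    refine proj_eq_proj.2 fun i => ⟨-⌊v i⌋, ?_⟩
    simp only [PiLp.sub_apply, ← Int.self_sub_floor]
    push_cast; ring
  rw [h]
  refine hC ⟨_, ?_, rfl⟩
  rw [mem_closedBall_zero_iff, EuclideanSpace.norm_eq]
  refine Real.sqrt_le_sqrt ?_
  calc _ ≤ ∑ _i : Fin N, (1 : ℝ) := Finset.sum_le_sum fun i _ => by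
        simp only [Real.norm_eq_abs, sq_abs]
        nlinarith [Int.fract_nonneg (v i), Int.fract_lt_one (v i)]
    _ = N := by simp

/-- A `C¹` function touching `u` from above only locally, in a chart, may be replaced by a global
test function: it is glued by a bump function, periodized over `Γ`, to a `C¹` majorant of `u`. -/
lemma gradient_mem_superdifferential (hr : IsSeparated Γ r) (hB : HasC1Majorants Γ)
    {u : FlatSpace N Γ → ℝ} (hu : Continuous u) {ψ : Vec N → ℝ} (hψ : ContDiff ℝ 1 ψ)
    {z p : Vec N} (hz : ψ z = u (proj Γ z)) (hle : ∀ᶠ w in 𝓝 z, u (proj Γ w) ≤ ψ w)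
    (hp : HasGradientAt ψ p z) : p ∈ superdifferential u (proj Γ z) := by
  obtain ⟨B, hB1, hBu⟩ := hB u hu
  obtain ⟨ρ, hρ, hle⟩ := Metric.eventually_nhds_iff_ball.1 hle
  set R := min ρ (r / 4)
  have hR0 : 0 < R := lt_min hρ (by linarith [hr.1])
  have hRr : R ≤ r / 4 := min_le_right _ _
  let χ : ContDiffBump z := ⟨R / 2, R, half_pos hR0, half_lt_self hR0⟩
  let F : Vec N → ℝ := fun w => χ w * (ψ w - B (proj Γ w))
  have hF : ContDiff ℝ 1 F := χ.contDiff.mul (hψ.sub hB1)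
  have hF0 : ∀ w, w ∉ Metric.ball z R → F w = 0 := fun w hw => by
    have : χ w = 0 := by
      rw [← Function.notMem_support, χ.support_eq]; exact hw
    simp [F, this]
  -- at most one translate of a point lies near the ball carrying the bump
  have huniq : ∀ w w' : Vec N, w ∈ Metric.ball z (2 * R) → w' ∈ Metric.ball z (2 * R) →
      w' - w ∈ Γ → w' = w := fun w w' hw hw' hk => by
    refine sub_eq_zero.1 (hr.2 _ hk ?_)
    rw [Metric.mem_ball] at hw hw'
    have := dist_triangle_right w' w z
    rw [← dist_eq_norm]; linarith
  let G : Vec N → ℝ := fun v => ∑ᶠ k : Γ, F (v + k)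
  have hG1 : ∀ v, v ∈ Metric.ball z (2 * R) → G v = F v := fun v hv => by
    have : G v = F (v + (0 : Γ)) := by
      refine finsum_eq_single _ _ fun k hk => hF0 _ fun hmem => hk ?_
      have := huniq _ _ hv (Metric.ball_subset_ball (by linarith) hmem) (by simp)
      exact Subtype.ext (by simpa using this)
    simpa using this
  have hGper : ∀ v, ∀ k : Γ, G (v + k) = G v := fun v k => by
    simp only [G]
    rw [← finsum_comp_equiv (Equiv.addLeft k) (f := fun l : Γ => F (v + l))]
    exact finsum_congr fun l => by simp [add_assoc]
  have hG0 : ∀ v : Vec N, (∀ k : Γ, v + (k : Vec N) ∉ Metric.ball z R) → G v = 0 := fun v hv =>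
    finsum_eq_zero_of_forall_eq_zero fun k => hF0 _ (hv k)
  have hGC1 : ContDiff ℝ 1 G := by
    refine contDiff_iff_contDiffAt.2 fun v => ?_
    by_cases hv : ∃ k : Γ, v + (k : Vec N) ∈ Metric.ball z (2 * R)
    · obtain ⟨k, hk⟩ := hv
      have h1 : ContDiffAt ℝ 1 (fun w => F (w + k)) v := by
        have : ContDiff ℝ 1 (fun w => F (w + k)) := by fun_prop
        exact this.contDiffAt
      refine h1.congr_of_eventuallyEq ?_
      have : ContinuousAt (fun w : Vec N => w + (k : Vec N)) v := by fun_prop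
      filter_upwards [this (Metric.isOpen_ball.mem_nhds hk)] with w hw
      rw [← hGper w k, hG1 _ hw]
    · push Not at hv
      refine (contDiffAt_const (c := (0 : ℝ))).congr_of_eventuallyEq ?_
      filter_upwards [Metric.ball_mem_nhds v hR0] with w hw
      refine hG0 w fun k hk => hv k ?_
      rw [Metric.mem_ball] at hk hw ⊢
      have h1 := dist_triangle (v + (k : Vec N)) (w + k) z
      rw [dist_add_right, dist_comm v] at h1
      linarith
  let φ : FlatSpace N Γ → ℝ := fun y => B y + G (Quotient.out y)
  have hφ : ∀ v, φ (proj Γ v) = B (proj Γ v) + G v := fun v => by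
    have h1 : proj Γ (Quotient.out (proj Γ v) : Vec N) = proj Γ v := Quotient.out_eq _
    have h2 := hGper v ⟨_, proj_eq_proj.1 h1.symm⟩
    rw [add_sub_cancel] at h2
    simp only [φ, h2]
  have hφ1 : ∀ v ∈ Metric.ball z (2 * R),
      φ (proj Γ v) = (1 - χ v) * B (proj Γ v) + χ v * ψ v := fun v hv => by
    rw [hφ, hG1 v hv]; simp only [F]; ring
  have hφz : ∀ v ∈ Metric.ball z (R / 2), φ (proj Γ v) = ψ v := fun v hv => by
    have : χ v = 1 := χ.one_of_mem_closedBall (Metric.ball_subset_closedBall hv)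
    rw [hφ1 v (Metric.ball_subset_ball (by linarith) hv), this]; ring
  refine ⟨φ, ?_, ?_, ?_, ?_⟩
  · simp only [IsC1, hφ]
    exact hB1.add hGC1
  · rw [hφz z (Metric.mem_ball_self (by linarith)), hz]
  · intro y
    obtain ⟨v, rfl⟩ := proj_surjective y
    by_cases hv : ∃ k : Γ, v + (k : Vec N) ∈ Metric.ball z R
    · obtain ⟨k, hk⟩ := hv
      have h1 : proj Γ v = proj Γ (v + k) := proj_eq_proj.2 (by simp)
      rw [h1, hφ1 _ (Metric.ball_subset_ball (by linarith) hk)]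
      have h2 := hle _ (Metric.ball_subset_ball (min_le_left _ _) hk)
      have h3 := hBu (proj Γ (v + k))
      nlinarith [χ.nonneg' (v + k), χ.le_one (x := v + k)]
    · push Not at hv
      rw [hφ, hG0 v hv, add_zero]
      exact hBu _
  · have h1 : HasGradientAt (fun v => φ (proj Γ v)) p z :=
      hp.congr_of_eventuallyEq (by
        filter_upwards [Metric.ball_mem_nhds z (half_pos hR0)] with v hv using hφz v hv)
    have h2 : HasFDerivAt (fun v : Vec N => z + v) (ContinuousLinearMap.id ℝ (Vec N)) 0 :=
      (hasFDerivAt_id _).const_add z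
    have h3 : HasFDerivAt (fun v => φ (proj Γ v)) (InnerProductSpace.toDual ℝ (Vec N) p)
        (z + 0) := by
      rw [add_zero]; exact h1
    exact h3.comp (0 : Vec N) h2

end TestFunctions

/-! ### Subsolutions along segments -/

section Subsolutions

variable {N : ℕ} {Γ : AddSubgroup (Vec N)} {r : ℝ} {H : FlatSpace N Γ → Vec N → ℝ}
  {u : FlatSpace N Γ → ℝ}

/-- If near a segment all momenta in the zero sublevels of `H` satisfy `⟨p, q⟩ ≤ m`, then a
subsolution grows by at most `m` along the translation by `q`. This is a viscosity argument: if it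
failed, the maximum of `u(z) - n‖z - x - tq‖² - m't` over `z` and `t ∈ [0, 1]`, for some `m' > m`
and large `n`, would be attained at some `t > 0`, and the quadratic term would provide a
superdifferential `p` of `u` with `⟨p, q⟩ ≥ m'`. -/
lemma IsSubsolution.sub_le_of_inner_le (hr : IsSeparated Γ r) (hB : HasC1Majorants Γ)
    (hu : IsSubsolution H 0 u) {x₀ x q : Vec N} {R m : ℝ}
    (hm : ∀ z ∈ Metric.ball x₀ R, ∀ p, H (proj Γ z) p ≤ 0 → inner ℝ p q ≤ m)
    (hx : x ∈ Metric.ball x₀ (R / 2)) (hxq : x + q ∈ Metric.ball x₀ (R / 2)) :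
    u (proj Γ (x + q)) - u (proj Γ x) ≤ m := by
  by_contra! hlt
  have hR : 0 < R := by linarith [dist_nonneg.trans_lt (Metric.mem_ball.1 hx)]
  have hU : Continuous fun z => u (proj Γ z) := hu.1.comp continuous_proj
  obtain ⟨m', hm1, hm2⟩ := exists_between hlt
  obtain ⟨C, hC⟩ := (isCompact_closedBall x₀ R).exists_bound_of_continuousOn hU.continuousOn
  obtain ⟨η, hη, hη'⟩ := Metric.eventually_nhds_iff_ball.1
    (hU.continuousAt.eventually (gt_mem_nhds
      (show u (proj Γ x) < u (proj Γ (x + q)) - m' by linarith)))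
  set s := min (R / 2) η
  have hs : 0 < s := lt_min (half_pos hR) hη
  obtain ⟨n, hn⟩ := exists_gt (max 1 ((2 * C + |m'|) / s ^ 2))
  have hn0 : 0 < n := by linarith [le_max_left 1 ((2 * C + |m'|) / s ^ 2)]
  have hns : 2 * C + |m'| < n * s ^ 2 :=
    (div_lt_iff₀ (by positivity)).1 ((le_max_right _ _).trans_lt hn)
  have hseg : ∀ t ∈ Icc (0 : ℝ) 1, x + t • q ∈ Metric.ball x₀ (R / 2) := fun t ht => by
    have := (convex_ball x₀ (R / 2)).add_smul_sub_mem hx hxq ht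
    simpa using this
  obtain ⟨⟨z, t⟩, ⟨hz, ht⟩, hmax⟩ :=
    ((isCompact_closedBall x₀ R).prod (isCompact_Icc (a := (0 : ℝ)) (b := 1))).exists_isMaxOn
      ⟨(x₀, 0), Metric.mem_closedBall_self hR.le, by simp⟩
      (f := fun y : Vec N × ℝ => u (proj Γ y.1) - n * ‖y.1 - (x + y.2 • q)‖ ^ 2 - m' * y.2)
      (by
        refine Continuous.continuousOn ?_
        have := hU.comp (continuous_fst (X := Vec N) (Y := ℝ))
        exact (this.sub (by fun_prop)).sub (by fun_prop))
  simp only at hz ht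
  have hxqR : x + q ∈ Metric.closedBall x₀ R :=
    Metric.ball_subset_closedBall (Metric.ball_subset_ball (by linarith) hxq)
  have h1 : u (proj Γ (x + q)) - m' ≤ u (proj Γ z) - n * ‖z - (x + t • q)‖ ^ 2 - m' * t := by
    have := hmax (a := (x + q, 1)) ⟨hxqR, by simp⟩
    simpa using this
  set a := z - (x + t • q) with ha
  have has : ‖a‖ < s := by
    have h2 := (abs_le.1 (hC z hz)).2
    have h3 := (abs_le.1 (hC _ hxqR)).1
    have h4 : m' * (1 - t) ≤ |m'| := by
      calc m' * (1 - t) ≤ |m'| * (1 - t) :=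
            mul_le_mul_of_nonneg_right (le_abs_self _) (by linarith [ht.2])
        _ ≤ |m'| * 1 := mul_le_mul_of_nonneg_left (by linarith [ht.1]) (abs_nonneg _)
        _ = |m'| := mul_one _
    have h5 : n * ‖a‖ ^ 2 < n * s ^ 2 := by linarith
    exact lt_of_pow_lt_pow_left₀ 2 hs.le (lt_of_mul_lt_mul_left h5 hn0.le)
  rcases ht.1.eq_or_lt with h0 | h0
  · subst h0
    have h2 : z ∈ Metric.ball x η := by
      rw [Metric.mem_ball, dist_eq_norm]
      simp only [zero_smul, add_zero] at ha
      exact ha ▸ has.trans_le (min_le_right _ _)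
    have := hη' z h2
    nlinarith [sq_nonneg ‖a‖]
  · have hzR : z ∈ Metric.ball x₀ R := by
      have h2 := hseg t ht
      rw [Metric.mem_ball, dist_eq_norm] at h2 ⊢
      have h3 : z - x₀ = a + (x + t • q - x₀) := by rw [ha]; abel
      have := norm_add_le a (x + t • q - x₀)
      have := has.trans_le (min_le_left _ _)
      rw [h3]; linarith
    have hp : (2 * n) • a ∈ superdifferential u (proj Γ z) := by
      refine gradient_mem_superdifferential hr hB hu.1
        (ψ := fun w => u (proj Γ z) + n * (‖w - (x + t • q)‖ ^ 2 - ‖a‖ ^ 2)) ?_ ?_ ?_ ?_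
      · exact contDiff_const.add (contDiff_const.mul
          (((contDiff_id.sub contDiff_const).norm_sq ℝ).sub contDiff_const))
      · simp [ha]
      · filter_upwards [Metric.isOpen_ball.mem_nhds hzR] with w hw
        have := hmax (a := (w, t)) ⟨Metric.ball_subset_closedBall hw, ht⟩
        simp only [mem_ofPred_eq, ← ha] at this
        linarith
      · have h2 : HasFDerivAt (fun w : Vec N => w - (x + t • q))
            (ContinuousLinearMap.id ℝ (Vec N)) z := (hasFDerivAt_id z).sub_const _
        have h3 := ((h2.norm_sq.sub_const (‖a‖ ^ 2)).const_mul n).const_add (u (proj Γ z))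
        rw [hasGradientAt_iff_hasFDerivAt]
        refine h3.congr_fderiv ?_
        ext v
        simp [← ha]
        ring
    have h2 := hm z hzR _ (hu.2 _ _ hp)
    rw [real_inner_smul_left] at h2
    set τ := min t ((m' - m) / (2 * (n * ‖q‖ ^ 2 + 1))) with hτ
    have hd : 0 < 2 * (n * ‖q‖ ^ 2 + 1) := by positivity
    have hτ0 : 0 < τ := lt_min h0 (div_pos (by linarith) hd)
    have h3 : τ * (2 * (n * ‖q‖ ^ 2 + 1)) ≤ m' - m :=
      (le_div_iff₀ hd).1 (min_le_right _ _)
    have hτt : τ ≤ t := min_le_left _ _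
    have h4 := hmax (a := (z, t - τ)) ⟨hz, sub_nonneg.2 hτt, by simp only; linarith [ht.2]⟩
    have h5 : z - (x + (t - τ) • q) = a + τ • q := by rw [ha, sub_smul]; abel
    simp only [mem_ofPred_eq, ← ha, h5, norm_add_sq_real, norm_smul, real_inner_smul_right,
      Real.norm_eq_abs, mul_pow, sq_abs] at h4
    have h6 : τ * m' ≤ τ * (2 * n * inner ℝ a q + n * τ * ‖q‖ ^ 2) := by linarith
    have h7 := le_of_mul_le_mul_left h6 hτ0
    nlinarith

/-- Uniform superlinearity of the Hamiltonian. -/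
lemma IsStrictlyConvexHamiltonian.exists_mul_norm_le (hH : IsStrictlyConvexHamiltonian H) (A : ℝ) :
    ∃ ρ : ℝ, 1 ≤ ρ ∧ ∀ x p, ρ ≤ ‖p‖ → A * ‖p‖ ≤ H x p := by
  obtain ⟨α, β, hα, -, h⟩ := hH.superlinear
  obtain ⟨ρ, hρ⟩ := eventually_atTop.1 (hα.eventually_ge_atTop A)
  refine ⟨max 1 ρ, le_max_left _ _, fun x p hp => le_trans ?_ (h x p).1⟩
  have h1 : 0 < ‖p‖ := one_pos.trans_le ((le_max_left _ _).trans hp)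
  exact (le_div_iff₀ h1).1 (hρ _ ((le_max_right _ _).trans hp))

/-- The zero sublevels of the Hamiltonian are uniformly bounded by `P`. -/
def SublevelBound (H : FlatSpace N Γ → Vec N → ℝ) (P : ℝ) : Prop :=
  0 ≤ P ∧ ∀ x p, H x p ≤ 0 → ‖p‖ ≤ P

lemma IsStrictlyConvexHamiltonian.exists_sublevelBound (hH : IsStrictlyConvexHamiltonian H) :
    ∃ P, SublevelBound H P := by
  obtain ⟨ρ, hρ1, hρ⟩ := hH.exists_mul_norm_le 1
  refine ⟨ρ, by linarith, fun x p hp => ?_⟩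
  by_contra! hlt
  have := hρ x p hlt.le
  linarith

lemma IsSubsolution.sub_le_mul_norm (hr : IsSeparated Γ r) (hB : HasC1Majorants Γ)
    (hu : IsSubsolution H 0 u) {P : ℝ} (hP : SublevelBound H P) (x y : Vec N) :
    u (proj Γ y) - u (proj Γ x) ≤ P * ‖y - x‖ := by
  have h := hu.sub_le_of_inner_le hr hB (x₀ := x) (x := x) (q := y - x) (R := 2 * (‖y - x‖ + 1))
    (m := P * ‖y - x‖) (fun z _ p hp => (real_inner_le_norm _ _).trans
      (mul_le_mul_of_nonneg_right (hP.2 _ _ hp) (norm_nonneg _)))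
    (Metric.mem_ball_self (by positivity)) (by simp [dist_eq_norm])
  simpa using h

lemma IsSubsolution.dist_le (hr : IsSeparated Γ r) (hB : HasC1Majorants Γ)
    (hu : IsSubsolution H 0 u) {P : ℝ} (hP : SublevelBound H P) (x y : Vec N) :
    dist (u (proj Γ x)) (u (proj Γ y)) ≤ P * dist x y := by
  rw [Real.dist_eq, abs_sub_le_iff, dist_eq_norm]
  refine ⟨?_, ?_⟩
  · exact hu.sub_le_mul_norm hr hB hP y x
  · rw [norm_sub_rev]
    exact hu.sub_le_mul_norm hr hB hP x y

/-- Strict upper bounds on the support function of the zero sublevel are stable. The sublevel may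
be empty here. -/
lemma IsStrictlyConvexHamiltonian.eventually_inner_lt (hH : IsStrictlyConvexHamiltonian H)
    {x : FlatSpace N Γ} {q : Vec N} {m : ℝ} (h : ∀ p, H x p ≤ 0 → inner ℝ q p < m) :
    ∀ᶠ z : FlatSpace N Γ × Vec N in 𝓝 (x, q), ∀ p, H z.1 p ≤ 0 → inner ℝ z.2 p < m := by
  obtain ⟨P, hP⟩ := hH.exists_sublevelBound
  have h1 : ∀ᶠ z : FlatSpace N Γ × Vec N in 𝓝 (x, q), ∀ p ∈ Metric.closedBall (0 : Vec N) P,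
      0 < H z.1 p ∨ inner ℝ z.2 p < m := by
    refine (isCompact_closedBall (0 : Vec N) P).eventually_forall_of_forall_eventually
      fun p _ => ?_
    have hopen : IsOpen {w : (FlatSpace N Γ × Vec N) × Vec N |
        0 < H w.1.1 w.2 ∨ inner ℝ w.1.2 w.2 < m} := by
      have hcont : Continuous fun w : (FlatSpace N Γ × Vec N) × Vec N => inner ℝ w.1.2 w.2 := by
        fun_prop
      have hHcont : Continuous fun w : (FlatSpace N Γ × Vec N) × Vec N => H w.1.1 w.2 :=
        hH.continuous.comp ((continuous_fst.comp continuous_fst).prodMk continuous_snd)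
      exact (isOpen_lt continuous_const hHcont).union (isOpen_lt hcont continuous_const)
    refine hopen.mem_nhds ?_
    by_cases hp : H x p ≤ 0
    · exact Or.inr (h p hp)
    · exact Or.inl (not_le.1 hp)
  filter_upwards [h1] with z hz p hp
  exact (hz p (mem_closedBall_zero_iff.2 (hP.2 _ _ hp))).resolve_left (not_lt.2 hp)

/-- If the zero sublevel at `x` were empty, so would be those at nearby points, and any bound on the
increments of a subsolution would hold vacuously there, even a negative one on the zero
increment. -/
lemma IsSubsolution.exists_nonpos (hH : IsStrictlyConvexHamiltonian H) (hr : IsSeparated Γ r)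
    (hB : HasC1Majorants Γ) (hu : IsSubsolution H 0 u) (x : FlatSpace N Γ) : ∃ p, H x p ≤ 0 := by
  by_contra! hx
  obtain ⟨v, rfl⟩ := proj_surjective x
  have h1 := hH.eventually_inner_lt (x := proj Γ v) (q := 0) (m := 0)
    fun p hp => absurd hp (not_le.2 (hx p))
  have h2 : ContinuousAt (fun z : Vec N => (proj Γ z, (0 : Vec N))) v :=
    (continuous_proj.prodMk continuous_const).continuousAt
  obtain ⟨R, hR, h3⟩ := Metric.eventually_nhds_iff_ball.1 (h2.eventually h1)
  have := hu.sub_le_of_inner_le hr hB (x₀ := v) (x := v) (q := 0) (R := R) (m := -1)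
    (fun z hz p hp => absurd (h3 z hz p hp) (by simp))
    (Metric.mem_ball_self (half_pos hR)) (by simpa using half_pos hR)
  simp only [add_zero, sub_self] at this
  linarith

/-! ### The support function -/

lemma SublevelBound.bddAbove {P : ℝ} (hP : SublevelBound H P) (x : FlatSpace N Γ) (q : Vec N) :
    BddAbove {s : ℝ | ∃ p : Vec N, H x p ≤ 0 ∧ s = inner ℝ q p} := by
  refine ⟨‖q‖ * P, ?_⟩
  rintro _ ⟨p, hp, rfl⟩
  exact (real_inner_le_norm _ _).trans (mul_le_mul_of_nonneg_left (hP.2 _ _ hp) (norm_nonneg _))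

lemma SublevelBound.inner_le_supportFun {P : ℝ} (hP : SublevelBound H P) {x : FlatSpace N Γ}
    {p : Vec N} (hp : H x p ≤ 0) (q : Vec N) : inner ℝ q p ≤ supportFun H 0 x q :=
  le_csSup (hP.bddAbove x q) ⟨p, hp, rfl⟩

lemma supportFun_le {x : FlatSpace N Γ} (hne : ∃ p, H x p ≤ 0) {q : Vec N} {m : ℝ}
    (h : ∀ p, H x p ≤ 0 → inner ℝ q p ≤ m) : supportFun H 0 x q ≤ m := by
  obtain ⟨p, hp⟩ := hne
  refine csSup_le ⟨_, p, hp, rfl⟩ ?_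
  rintro _ ⟨p', hp', rfl⟩
  exact h p' hp'

lemma SublevelBound.abs_supportFun_le {P : ℝ} (hP : SublevelBound H P) {x : FlatSpace N Γ}
    (hne : ∃ p, H x p ≤ 0) (q : Vec N) : |supportFun H 0 x q| ≤ P * ‖q‖ := by
  obtain ⟨p, hp⟩ := hne
  have h : ∀ p, H x p ≤ 0 → |inner ℝ q p| ≤ P * ‖q‖ := fun p hp =>
    (abs_real_inner_le_norm _ _).trans (by
      rw [mul_comm]; exact mul_le_mul_of_nonneg_right (hP.2 _ _ hp) (norm_nonneg _))
  refine abs_le.2 ⟨?_, supportFun_le ⟨p, hp⟩ fun p hp => (abs_le.1 (h p hp)).2⟩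
  exact (abs_le.1 (h p hp)).1.trans (hP.inner_le_supportFun hp q)

lemma IsStrictlyConvexHamiltonian.upperSemicontinuous_supportFun
    (hH : IsStrictlyConvexHamiltonian H) (hne : ∀ x, ∃ p, H x p ≤ 0) :
    UpperSemicontinuous fun z : FlatSpace N Γ × Vec N => supportFun H 0 z.1 z.2 := by
  obtain ⟨P, hP⟩ := hH.exists_sublevelBound
  intro z m hm
  obtain ⟨m', h1, h2⟩ := exists_between hm
  have := hH.eventually_inner_lt (x := z.1) (q := z.2) (m := m')
    fun p hp => (hP.inner_le_supportFun hp _).trans_lt h1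
  filter_upwards [this] with w hw
  exact (supportFun_le (hne _) fun p hp => (hw p hp).le).trans_lt h2

/-! ### Subsolutions along curves -/

/-- The chain rule inequality along a curve, at points where both derivatives exist; the subsolution
itself need not be differentiable there. -/
lemma IsSubsolution.deriv_le_supportFun (hH : IsStrictlyConvexHamiltonian H) (hr : IsSeparated Γ r)
    (hB : HasC1Majorants Γ) (hu : IsSubsolution H 0 u) {c : ℝ → Vec N} {t g : ℝ} {v : Vec N}
    (hc : HasDerivAt c v t) (hg : HasDerivAt (fun s => u (proj Γ (c s))) g t) :
    g ≤ supportFun H 0 (proj Γ (c t)) v := by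
  obtain ⟨P, hP⟩ := hH.exists_sublevelBound
  refine le_of_forall_gt_imp_ge_of_dense fun m hm => ?_
  have h1 := hH.eventually_inner_lt (x := proj Γ (c t)) (q := v) (m := m)
    fun p hp => (hP.inner_le_supportFun hp _).trans_lt hm
  have h2 : ContinuousAt (fun z : Vec N × Vec N => (proj Γ z.1, z.2)) (c t, v) :=
    ((continuous_proj.comp continuous_fst).prodMk continuous_snd).continuousAt
  obtain ⟨R, hR, h3⟩ := Metric.eventually_nhds_iff_ball.1 (h2.eventually h1)
  rw [hasDerivAt_iff_tendsto_slope_zero] at hc hg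
  have hc' := hc.mono_left (nhdsGT_le_nhdsNE (0 : ℝ))
  have hg' := hg.mono_left (nhdsGT_le_nhdsNE (0 : ℝ))
  refine le_of_tendsto hg' ?_
  have h4 : ∀ᶠ s in 𝓝[>] (0 : ℝ), s⁻¹ • (c (t + s) - c t) ∈ Metric.ball v R :=
    hc' (Metric.ball_mem_nhds v hR)
  have h5 : Tendsto (fun s : ℝ => s • s⁻¹ • (c (t + s) - c t)) (𝓝[>] 0) (𝓝 ((0 : ℝ) • v)) :=
    (tendsto_id.mono_left nhdsWithin_le_nhds).smul hc'
  rw [zero_smul] at h5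
  have h6 := h5 (Metric.ball_mem_nhds 0 (half_pos hR))
  filter_upwards [h4, h6, self_mem_nhdsWithin] with s hs4 hs6 hs
  rw [mem_Ioi] at hs
  set q := s⁻¹ • (c (t + s) - c t)
  have h7 : c (t + s) = c t + s • q := by simp [q, smul_smul, hs.ne']
  have h8 := hu.sub_le_of_inner_le hr hB (x₀ := c t) (x := c t) (q := s • q) (R := R) (m := s * m)
    (fun z hz p hp => by
      rw [real_inner_smul_right, real_inner_comm]
      refine mul_le_mul_of_nonneg_left (h3 (z, q) ?_ p hp).le hs.le
      rw [← ball_prod_same]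
      exact ⟨hz, hs4⟩)
    (Metric.mem_ball_self (half_pos hR)) (by
      rw [mem_preimage, mem_ball_zero_iff] at hs6
      simpa using hs6)
  rw [← h7] at h8
  rw [smul_eq_mul, inv_mul_le_iff₀ hs]
  exact h8

lemma AbsolutelyContinuousOnInterval.of_dist_le {X Y : Type*} [PseudoMetricSpace X]
    [PseudoMetricSpace Y] {f : ℝ → X} {g : ℝ → Y} {a b K : ℝ}
    (hf : AbsolutelyContinuousOnInterval f a b)
    (h : ∀ s t, dist (g s) (g t) ≤ K * dist (f s) (f t)) :
    AbsolutelyContinuousOnInterval g a b := by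
  have h1 := Tendsto.const_mul K hf
  rw [mul_zero] at h1
  refine squeeze_zero (fun E => Finset.sum_nonneg fun _ _ => dist_nonneg) (fun E => ?_) h1
  rw [Finset.mul_sum]
  exact Finset.sum_le_sum fun i _ => h _ _

lemma AbsolutelyContinuousOnInterval.intervalIntegrable_norm_deriv {c : ℝ → Vec N} {a b : ℝ}
    (hc : AbsolutelyContinuousOnInterval c a b) :
    IntervalIntegrable (fun s => ‖deriv c s‖) volume a b := by
  have h1 : ∀ i, IntervalIntegrable (deriv fun s => c s i) volume a b := fun i =>
    (hc.of_dist_le (K := 1) fun s t => by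
      rw [one_mul, dist_eq_norm, dist_eq_norm]
      exact PiLp.norm_apply_le (c s - c t) i).intervalIntegrable_deriv
  have h2 : IntervalIntegrable (∑ i, fun s => ‖deriv (fun s => c s i) s‖) volume a b :=
    IntervalIntegrable.sum _ fun i _ => (h1 i).norm
  refine h2.mono_fun' (measurable_deriv c).norm.aestronglyMeasurable (ae_of_all _ fun s => ?_)
  simp only [norm_norm, Finset.sum_apply]
  by_cases hs : DifferentiableAt ℝ c s
  · have h3 : ∀ i, deriv (fun s => c s i) s = deriv c s i := fun i =>
      ((EuclideanSpace.proj i : Vec N →L[ℝ] ℝ).hasFDerivAt.comp_hasDerivAt s hs.hasDerivAt).deriv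
    simp only [h3]
    calc ‖deriv c s‖ = ‖∑ i, deriv c s i • EuclideanSpace.basisFun (Fin N) ℝ i‖ := by
          conv_lhs => rw [← (EuclideanSpace.basisFun (Fin N) ℝ).sum_repr (deriv c s)]
          simp
      _ ≤ ∑ i, ‖deriv c s i‖ := (norm_sum_le _ _).trans (Finset.sum_le_sum fun i _ => by
          simp [norm_smul])
  · rw [deriv_zero_of_not_differentiableAt hs]
    simpa using Finset.sum_nonneg fun i _ => norm_nonneg (deriv (fun s => c s i) s)

lemma IsStrictlyConvexHamiltonian.intervalIntegrable_supportFun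
    (hH : IsStrictlyConvexHamiltonian H) (hne : ∀ x, ∃ p, H x p ≤ 0) {c : ℝ → Vec N} {a b : ℝ}
    (hc : Continuous c) (hac : AbsolutelyContinuousOnInterval c a b) :
    IntervalIntegrable (fun s => supportFun H 0 (proj Γ (c s)) (deriv c s)) volume a b := by
  obtain ⟨P, hP⟩ := hH.exists_sublevelBound
  have h1 : UpperSemicontinuous fun z : Vec N × Vec N => supportFun H 0 (proj Γ z.1) z.2 :=
    (hH.upperSemicontinuous_supportFun hne).comp
      ((continuous_proj.comp continuous_fst).prodMk continuous_snd)
  have h2 : Measurable fun s => supportFun H 0 (proj Γ (c s)) (deriv c s) :=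
    h1.measurable.comp (hc.measurable.prodMk (measurable_deriv c))
  exact (hac.intervalIntegrable_norm_deriv.const_mul P).mono_fun' h2.aestronglyMeasurable
    (ae_of_all _ fun s => hP.abs_supportFun_le (hne _) _)

lemma IsSubsolution.sub_le_integral_supportFun (hH : IsStrictlyConvexHamiltonian H)
    (hr : IsSeparated Γ r) (hB : HasC1Majorants Γ) (hu : IsSubsolution H 0 u) {c : ℝ → Vec N}
    {a b : ℝ} (hab : a ≤ b) (hc : Continuous c) (hac : AbsolutelyContinuousOnInterval c a b) :
    u (proj Γ (c b)) - u (proj Γ (c a)) ≤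
      ∫ s in a..b, supportFun H 0 (proj Γ (c s)) (deriv c s) := by
  obtain ⟨P, hP⟩ := hH.exists_sublevelBound
  have hg : AbsolutelyContinuousOnInterval (fun s => u (proj Γ (c s))) a b :=
    hac.of_dist_le fun s t => hu.dist_le hr hB hP (c s) (c t)
  rw [← hg.integral_deriv_eq_sub]
  refine intervalIntegral.integral_mono_ae_restrict hab hg.intervalIntegrable_deriv
    (hH.intervalIntegrable_supportFun (hu.exists_nonpos hH hr hB) hc hac) ?_
  refine (ae_restrict_iff' measurableSet_Icc).2 ?_
  filter_upwards [hg.ae_differentiableAt, hac.boundedVariationOn.ae_differentiableAt_of_mem_uIcc]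
    with s h1 h2 hs
  rw [← uIcc_of_le hab] at hs
  exact hu.deriv_le_supportFun hH hr hB (h2 hs).hasDerivAt (h1 hs).hasDerivAt

lemma IsSubsolution.sub_le_semidistance (hH : IsStrictlyConvexHamiltonian H)
    (hr : IsSeparated Γ r) (hB : HasC1Majorants Γ) (hu : IsSubsolution H 0 u)
    (x y : FlatSpace N Γ) : u y - u x ≤ semidistance H 0 x y := by
  refine le_csInf ?_ ?_
  · -- without a competitor the infimum would have the default value `0`
    obtain ⟨v, rfl⟩ := proj_surjective x
    obtain ⟨w, rfl⟩ := proj_surjective y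
    refine ⟨_, fun s => proj Γ (v + s • (w - v)), ⟨‖w - v‖₊, ?_⟩, by simp, by simp, rfl⟩
    refine LipschitzOnWith.of_dist_le_mul fun s _ t _ => ?_
    rw [dist_eq_norm, ← proj_sub]
    refine (norm_proj_le _).trans ?_
    rw [add_sub_add_left_eq_sub, ← sub_smul, norm_smul, mul_comm]
    simp [Real.dist_eq]
  · rintro _ ⟨γ, ⟨K, hK⟩, rfl, rfl, rfl⟩
    have hcont : Continuous (IccExtend zero_le_one ((Icc (0 : ℝ) 1).domRestrict γ)) :=
      (continuousOn_iff_continuous_domRestrict.1 hK.continuousOn).Icc_extend'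
    obtain ⟨c, hc, hcγ'⟩ := hr.exists_lift hcont
    have hcγ : ∀ t ∈ Icc (0 : ℝ) 1, proj Γ (c t) = γ t := fun t ht => by
      rw [hcγ', IccExtend_of_mem _ _ ht]; rfl
    have hac : AbsolutelyContinuousOnInterval c 0 1 := by
      refine hr.absolutelyContinuousOnInterval_lift hc.continuousOn
        (by rwa [uIcc_of_le zero_le_one]) ?_
      rw [← uIcc_of_le (zero_le_one' ℝ)] at hK
      exact hK.absolutelyContinuousOnInterval
    have h1 := hu.sub_le_integral_supportFun hH hr hB zero_le_one hc hac
    rw [hcγ 0 (by simp), hcγ 1 (by simp)] at h1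
    refine h1.trans_eq (intervalIntegral.integral_congr_ae ?_)
    have h2 : ∀ᵐ s : ℝ, s ≠ 1 := by simp [ae_iff, measure_singleton]
    filter_upwards [h2] with s hs1 hs
    rw [uIoc_of_le zero_le_one] at hs
    have hs' : Ioo (0 : ℝ) 1 ∈ 𝓝 s := Ioo_mem_nhds hs.1 (lt_of_le_of_ne hs.2 hs1)
    rw [hcγ s ⟨hs.1.le, hs.2⟩, hr.velocity_eq_deriv hc.continuousAt]
    filter_upwards [hs'] with t ht using hcγ t (Ioo_subset_Icc_self ht)

end Subsolutions

/-! ### The Lagrangian -/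

section Lagrangian

variable {N : ℕ} {Γ : AddSubgroup (Vec N)} {H : FlatSpace N Γ → Vec N → ℝ}

/-- `p` realizes the supremum that defines `L(x, q)`. -/
def IsMomentum (H : FlatSpace N Γ → Vec N → ℝ) (x : FlatSpace N Γ) (q p : Vec N) : Prop :=
  ∀ p', inner ℝ p' q - H x p' ≤ inner ℝ p q - H x p

/-- The Legendre transform of `q`: the maximizer in the definition of `L(x, q)`. It is unique by
strict convexity, and turns out to be `D_q L(x, q)`. -/
noncomputable def momentum (H : FlatSpace N Γ → Vec N → ℝ) (x : FlatSpace N Γ) (q : Vec N) :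
    Vec N :=
  Classical.epsilon (IsMomentum H x q)

namespace IsMomentum

lemma lagrangian_eq {x : FlatSpace N Γ} {q p : Vec N} (h : IsMomentum H x q p) :
    lagrangian H x q = inner ℝ p q - H x p :=
  le_antisymm (ciSup_le h) (le_ciSup (f := fun p => inner ℝ p q - H x p) ⟨_, by
    rintro _ ⟨p', rfl⟩; exact h p'⟩ p)

lemma eq (hH : IsStrictlyConvexHamiltonian H) {x : FlatSpace N Γ} {q p p' : Vec N}
    (h : IsMomentum H x q p) (h' : IsMomentum H x q p') : p = p' := by
  have hconv : StrictConvexOn ℝ univ (H x + fun p => -inner ℝ p q) := by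
    refine (hH.strictConvex x).add_convexOn ⟨convex_univ, fun y _ z _ a b _ _ _ => ?_⟩
    simp [inner_add_left, real_inner_smul_left]
  refine hconv.eq_of_isMinOn (fun y _ => ?_) (fun y _ => ?_) (mem_univ p) (mem_univ p')
  · have := h y
    simp only [mem_ofPred_eq, Pi.add_apply]; linarith
  · have := h' y
    simp only [mem_ofPred_eq, Pi.add_apply]; linarith

end IsMomentum

namespace IsStrictlyConvexHamiltonian

lemma continuous_apply (hH : IsStrictlyConvexHamiltonian H) (x : FlatSpace N Γ) :
    Continuous (H x) :=
  hH.continuous.comp (continuous_const.prodMk continuous_id)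

lemma exists_bound_of_isMomentum (hH : IsStrictlyConvexHamiltonian H) (A : ℝ) :
    ∃ ρ : ℝ, 0 ≤ ρ ∧ ∀ x q p, ‖q‖ ≤ A → inner ℝ 0 q - H x 0 ≤ inner ℝ p q - H x p → ‖p‖ ≤ ρ := by
  obtain ⟨α, β, -, -, hβ⟩ := hH.superlinear
  obtain ⟨ρ, hρ1, hρ⟩ := hH.exists_mul_norm_le (A + 1)
  refine ⟨max ρ |β 0|, by positivity, fun x q p hq h => ?_⟩
  by_contra! hlt
  have h1 := hρ x p ((le_max_left _ _).trans hlt.le)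
  have h2 := (le_max_right ρ |β 0|).trans_lt hlt
  have h3 : inner ℝ p q ≤ A * ‖p‖ := (real_inner_le_norm p q).trans (by
    rw [mul_comm]; exact mul_le_mul_of_nonneg_right hq (norm_nonneg _))
  have h4 := (hβ x 0).2
  rw [norm_zero] at h4
  rw [inner_zero_left] at h
  linarith [le_abs_self (β 0)]

lemma isMomentum_momentum (hH : IsStrictlyConvexHamiltonian H) (x : FlatSpace N Γ) (q : Vec N) :
    IsMomentum H x q (momentum H x q) := by
  refine Classical.epsilon_spec (p := IsMomentum H x q) ?_
  obtain ⟨ρ, hρ0, hρ⟩ := hH.exists_bound_of_isMomentum ‖q‖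
  have hcont : Continuous fun p : Vec N => inner ℝ p q - H x p :=
    (by fun_prop : Continuous fun p : Vec N => inner ℝ p q).sub (hH.continuous_apply x)
  obtain ⟨p, -, hp⟩ := (isCompact_closedBall (0 : Vec N) ρ).exists_isMaxOn
    ⟨0, Metric.mem_closedBall_self hρ0⟩ hcont.continuousOn
  refine ⟨p, fun p' => ?_⟩
  have h0 : inner ℝ 0 q - H x 0 ≤ inner ℝ p q - H x p := hp (Metric.mem_closedBall_self hρ0)
  by_contra! hlt
  have h1 := hρ x q p' le_rfl (h0.trans hlt.le)
  exact absurd (hp (mem_closedBall_zero_iff.2 h1)) (not_le.2 hlt)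

lemma exists_norm_momentum_le (hH : IsStrictlyConvexHamiltonian H) (A : ℝ) :
    ∃ ρ : ℝ, ∀ x q, ‖q‖ ≤ A → ‖momentum H x q‖ ≤ ρ := by
  obtain ⟨ρ, -, hρ⟩ := hH.exists_bound_of_isMomentum A
  exact ⟨ρ, fun x q hq => hρ x q _ hq (hH.isMomentum_momentum x q 0)⟩

lemma lagrangian_eq (hH : IsStrictlyConvexHamiltonian H) (x : FlatSpace N Γ) (q : Vec N) :
    lagrangian H x q = inner ℝ (momentum H x q) q - H x (momentum H x q) :=
  (hH.isMomentum_momentum x q).lagrangian_eq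

lemma inner_sub_le_lagrangian (hH : IsStrictlyConvexHamiltonian H) (x : FlatSpace N Γ)
    (q p : Vec N) : inner ℝ p q - H x p ≤ lagrangian H x q := by
  rw [hH.lagrangian_eq]
  exact hH.isMomentum_momentum x q p

lemma continuous_momentum (hH : IsStrictlyConvexHamiltonian H) :
    Continuous fun z : FlatSpace N Γ × Vec N => momentum H z.1 z.2 := by
  refine continuous_iff_continuousAt.2 fun ⟨x, q⟩ => tendsto_nhds.2 fun V hV hmem => ?_
  obtain ⟨ρ, hρ⟩ := hH.exists_norm_momentum_le (‖q‖ + 1)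
  -- outside `V` no `p` is a momentum of `(x, q)`, hence none is one of nearby points
  have h1 : ∀ᶠ z : FlatSpace N Γ × Vec N in 𝓝 (x, q), ∀ p ∈ Metric.closedBall (0 : Vec N) ρ \ V,
      ¬ IsMomentum H z.1 z.2 p := by
    refine ((isCompact_closedBall (0 : Vec N) ρ).diff hV).eventually_forall_of_forall_eventually
      fun p hp => ?_
    have h2 : ¬ IsMomentum H x q p := fun h =>
      hp.2 ((h.eq hH (hH.isMomentum_momentum x q)) ▸ hmem)
    simp only [IsMomentum, not_forall, not_le] at h2
    obtain ⟨p', hp'⟩ := h2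
    have hf : Continuous fun w : (FlatSpace N Γ × Vec N) × Vec N =>
        inner ℝ w.2 w.1.2 - H w.1.1 w.2 :=
      (by fun_prop : Continuous fun w : (FlatSpace N Γ × Vec N) × Vec N => inner ℝ w.2 w.1.2).sub
        (hH.continuous.comp ((continuous_fst.comp continuous_fst).prodMk continuous_snd))
    have hg : Continuous fun w : (FlatSpace N Γ × Vec N) × Vec N =>
        inner ℝ p' w.1.2 - H w.1.1 p' :=
      (by fun_prop : Continuous fun w : (FlatSpace N Γ × Vec N) × Vec N => inner ℝ p' w.1.2).sub
        (hH.continuous.comp ((continuous_fst.comp continuous_fst).prodMk continuous_const))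
    filter_upwards [(isOpen_lt hf hg).mem_nhds hp'] with w hw h
    exact absurd (h p') (not_le.2 hw)
  have h2 : ∀ᶠ z : FlatSpace N Γ × Vec N in 𝓝 (x, q), ‖z.2‖ < ‖q‖ + 1 :=
    (continuous_snd.norm.continuousAt (x := (x, q))).eventually (gt_mem_nhds (lt_add_one ‖q‖))
  filter_upwards [h1, h2] with z hz1 hz2
  by_contra hzV
  exact hz1 _ ⟨mem_closedBall_zero_iff.2 (hρ _ _ hz2.le), hzV⟩ (hH.isMomentum_momentum _ _)

lemma continuous_lagrangian (hH : IsStrictlyConvexHamiltonian H) :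
    Continuous fun z : FlatSpace N Γ × Vec N => lagrangian H z.1 z.2 := by
  simp only [hH.lagrangian_eq]
  exact (hH.continuous_momentum.inner continuous_snd).sub
    (hH.continuous.comp (continuous_fst.prodMk hH.continuous_momentum))

lemma lagrangian_sub_le (hH : IsStrictlyConvexHamiltonian H) (x : FlatSpace N Γ) (q q' : Vec N) :
    lagrangian H x q' - lagrangian H x q ≤ inner ℝ (momentum H x q') (q' - q) := by
  have := hH.inner_sub_le_lagrangian x q (momentum H x q')
  rw [hH.lagrangian_eq x q', inner_sub_right]
  linarith

lemma hasGradientAt_lagrangian (hH : IsStrictlyConvexHamiltonian H) (x : FlatSpace N Γ)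
    (q : Vec N) : HasGradientAt (lagrangian H x) (momentum H x q) q := by
  rw [hasGradientAt_iff_isLittleO, Asymptotics.isLittleO_iff]
  intro ε hε
  have h1 : Continuous fun q' => momentum H x q' :=
    hH.continuous_momentum.comp (continuous_const.prodMk continuous_id)
  filter_upwards [h1.continuousAt (Metric.ball_mem_nhds (momentum H x q) hε)] with q' hq'
  rw [mem_preimage, Metric.mem_ball, dist_eq_norm] at hq'
  have h2 := hH.lagrangian_sub_le x q q'
  have h3 := hH.lagrangian_sub_le x q' q
  rw [← neg_sub q' q, inner_neg_right] at h3
  have h4 : inner ℝ (momentum H x q' - momentum H x q) (q' - q) ≤ ε * ‖q' - q‖ :=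
    (real_inner_le_norm _ _).trans (mul_le_mul_of_nonneg_right hq'.le (norm_nonneg _))
  rw [inner_sub_left] at h4
  rw [Real.norm_eq_abs, abs_le]
  constructor <;> nlinarith [mul_nonneg hε.le (norm_nonneg (q' - q))]

lemma lagrangianGrad_eq_momentum (hH : IsStrictlyConvexHamiltonian H) (x : FlatSpace N Γ)
    (q : Vec N) : lagrangianGrad H x q = momentum H x q :=
  (hH.hasGradientAt_lagrangian x q).gradient

lemma supportFun_le_lagrangian (hH : IsStrictlyConvexHamiltonian H) {x : FlatSpace N Γ}
    (hne : ∃ p, H x p ≤ 0) (q : Vec N) : supportFun H 0 x q ≤ lagrangian H x q :=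
  supportFun_le hne fun p hp => by
    have := hH.inner_sub_le_lagrangian x q p
    rw [real_inner_comm]
    linarith

/-- The Lagrangian is superlinear in the velocity, uniformly in the base point. -/
lemma exists_norm_le_of_lagrangian_le (hH : IsStrictlyConvexHamiltonian H) {P : ℝ} (hP : 0 ≤ P) :
    ∃ Q : ℝ, ∀ x q, lagrangian H x q ≤ P * ‖q‖ → ‖q‖ ≤ Q := by
  obtain ⟨α, β, -, -, hβ⟩ := hH.superlinear
  refine ⟨max 0 (β (P + 1)), fun x q h => ?_⟩
  rcases eq_or_ne q 0 with rfl | hq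
  · simp
  have hq' : 0 < ‖q‖ := norm_pos_iff.2 hq
  have h1 := hH.inner_sub_le_lagrangian x q (((P + 1) / ‖q‖) • q)
  have h2 := (hβ x (((P + 1) / ‖q‖) • q)).2
  have h3 : ‖((P + 1) / ‖q‖) • q‖ = P + 1 := by
    rw [norm_smul, Real.norm_of_nonneg (by positivity), div_mul_cancel₀ _ hq'.ne']
  have h4 : inner ℝ (((P + 1) / ‖q‖) • q) q = (P + 1) * ‖q‖ := by
    rw [real_inner_smul_left, real_inner_self_eq_norm_sq]
    field_simp
  rw [h3] at h2
  rw [h4] at h1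
  exact le_max_of_le_right (by linarith)

end IsStrictlyConvexHamiltonian

end Lagrangian

/-! ### Calibrated curves -/

section Calibrated

variable {N : ℕ} {Γ : AddSubgroup (Vec N)} {r : ℝ} {H : FlatSpace N Γ → Vec N → ℝ}
  {u : FlatSpace N Γ → ℝ} {c : ℝ → Vec N}

/-- The curve `c` in `ℝ^N`, seen in `M`, is calibrated by `u`: along it `u` grows exactly by the
action. -/
structure IsCalibrated (H : FlatSpace N Γ → Vec N → ℝ) (u : FlatSpace N Γ → ℝ) (c : ℝ → Vec N) :
    Prop where
  continuous : Continuous c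
  absolutelyContinuous : ∀ a b, AbsolutelyContinuousOnInterval c a b
  integrable : ∀ a b, a < b →
    IntervalIntegrable (fun s => lagrangian H (proj Γ (c s)) (deriv c s)) volume a b
  sub_eq : ∀ a b, a < b → u (proj Γ (c b)) - u (proj Γ (c a)) =
    ∫ s in a..b, lagrangian H (proj Γ (c s)) (deriv c s)

/-- Static curves are calibrated by all critical subsolutions `u`: the semidistances between two of
its points in the two directions, which bound the increment of `u` from above and from below, are
opposite to each other. -/
lemma IsStaticCurve.isCalibrated (hH : IsStrictlyConvexHamiltonian H) (hr : IsSeparated Γ r)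
    (hB : HasC1Majorants Γ) (hu : IsSubsolution H 0 u) {γ : ℝ → FlatSpace N Γ}
    (hγ : IsStaticCurve H γ) (hc : Continuous c) (hcγ : ∀ t, proj Γ (c t) = γ t) :
    IsCalibrated H u c := by
  have hvel : ∀ t, velocity γ t = deriv c t := fun t =>
    hr.velocity_eq_deriv hc.continuousAt (Eventually.of_forall hcγ)
  refine ⟨hc, fun a b => hr.absolutelyContinuousOnInterval_lift hc.continuousOn (fun t _ => hcγ t)
    (hγ.1 a b), fun a b hab => ?_, fun a b hab => ?_⟩
  · simpa only [hcγ, hvel] using (hγ.2 a b hab).1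
  · obtain ⟨-, h1, h2⟩ := hγ.2 a b hab
    have h3 := hu.sub_le_semidistance hH hr hB (γ a) (γ b)
    have h4 := hu.sub_le_semidistance hH hr hB (γ b) (γ a)
    simp only [hcγ, ← hvel]
    linarith

namespace IsCalibrated

lemma ae_differentiableAt (hc : IsCalibrated H u c) : ∀ᵐ t, DifferentiableAt ℝ c t := by
  have h : ∀ᵐ t : ℝ, ∀ n : ℕ, t ∈ uIcc (-(n : ℝ)) n → DifferentiableAt ℝ c t :=
    ae_all_iff.2 fun n =>
      (hc.absolutelyContinuous _ _).boundedVariationOn.ae_differentiableAt_of_mem_uIcc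
  filter_upwards [h] with t ht
  obtain ⟨n, hn⟩ := exists_nat_ge |t|
  refine ht n ?_
  rw [uIcc_of_le (by linarith [abs_nonneg t])]
  exact abs_le.1 hn

/-- On a calibrated curve the Lagrangian agrees with the support function, hence has linear growth
in the velocity; by superlinearity the velocity is bounded. -/
lemma exists_ae_norm_deriv_le (hH : IsStrictlyConvexHamiltonian H) (hr : IsSeparated Γ r)
    (hB : HasC1Majorants Γ) (hu : IsSubsolution H 0 u) (hc : IsCalibrated H u c) :
    ∃ Q : ℝ, ∀ᵐ t, ‖deriv c t‖ ≤ Q := by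
  obtain ⟨P, hP⟩ := hH.exists_sublevelBound
  obtain ⟨Q, hQ⟩ := hH.exists_norm_le_of_lagrangian_le hP.1
  have hne := hu.exists_nonpos hH hr hB
  refine ⟨Q, ?_⟩
  have h : ∀ᵐ t : ℝ, ∀ n : ℕ, t ∈ Ioc (-((n : ℝ) + 1)) (n + 1) →
      lagrangian H (proj Γ (c t)) (deriv c t) - supportFun H 0 (proj Γ (c t)) (deriv c t) = 0 := by
    refine ae_all_iff.2 fun n => (ae_restrict_iff' measurableSet_Ioc).1 ?_
    have hn : -((n : ℝ) + 1) < n + 1 := by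
      have : (0 : ℝ) ≤ n := n.cast_nonneg
      linarith
    have h1 := hc.integrable _ _ hn
    have h2 := hH.intervalIntegrable_supportFun hne hc.continuous
      (hc.absolutelyContinuous (-((n : ℝ) + 1)) (n + 1))
    have h3 : ∀ t, 0 ≤ lagrangian H (proj Γ (c t)) (deriv c t) -
        supportFun H 0 (proj Γ (c t)) (deriv c t) := fun t =>
      sub_nonneg.2 (hH.supportFun_le_lagrangian (hne _) _)
    refine (intervalIntegral.integral_eq_zero_iff_of_le_of_nonneg_ae hn.le
      (ae_of_all _ h3) (h1.sub h2)).1 (le_antisymm ?_ ?_)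
    · rw [intervalIntegral.integral_sub h1 h2, ← hc.sub_eq _ _ hn, sub_nonpos]
      exact hu.sub_le_integral_supportFun hH hr hB hn.le hc.continuous (hc.absolutelyContinuous _ _)
    · exact intervalIntegral.integral_nonneg hn.le fun t _ => h3 t
  filter_upwards [h] with t ht
  obtain ⟨n, hn⟩ := exists_nat_ge |t|
  have h1 := abs_le.1 hn
  refine hQ (proj Γ (c t)) _ ?_
  rw [sub_eq_zero.1 (ht n ⟨by linarith [h1.1], by linarith [h1.2]⟩)]
  exact (le_abs_self _).trans (hP.abs_supportFun_le (hne _) _)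

lemma locallyIntegrable_momentum (hH : IsStrictlyConvexHamiltonian H) (hr : IsSeparated Γ r)
    (hB : HasC1Majorants Γ) (hu : IsSubsolution H 0 u) (hc : IsCalibrated H u c) :
    LocallyIntegrable (fun s => momentum H (proj Γ (c s)) (deriv c s)) volume := by
  obtain ⟨Q, hQ⟩ := hc.exists_ae_norm_deriv_le hH hr hB hu
  obtain ⟨ρ, hρ⟩ := hH.exists_norm_momentum_le Q
  have h1 : Continuous fun z : Vec N × Vec N => momentum H (proj Γ z.1) z.2 :=
    hH.continuous_momentum.comp ((continuous_proj.comp continuous_fst).prodMk continuous_snd)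
  have h2 : Measurable fun s => (c s, deriv c s) :=
    hc.continuous.measurable.prodMk (measurable_deriv c)
  have h3 : AEStronglyMeasurable (fun s => momentum H (proj Γ (c s)) (deriv c s)) volume :=
    (h1.measurable.comp h2).aestronglyMeasurable
  have h4 : ∀ᵐ s, ‖momentum H (proj Γ (c s)) (deriv c s)‖ ≤ ‖ρ‖ :=
    hQ.mono fun s hs => (hρ _ _ hs).trans (le_abs_self _)
  exact (locallyIntegrable_const ρ).mono h3 h4

/-- Comparison of a calibrated curve with the curve `s ↦ c(s) + (s - τ)v`. -/
lemma sub_sub_le (hH : IsStrictlyConvexHamiltonian H) (hr : IsSeparated Γ r)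
    (hB : HasC1Majorants Γ) (hu : IsSubsolution H 0 u) (hc : IsCalibrated H u c) {a b : ℝ}
    (hab : a < b) (τ : ℝ) (v : Vec N) {k : ℝ → ℝ} (hk : IntervalIntegrable k volume a b)
    (h : ∀ᵐ s, s ∈ Icc a b → lagrangian H (proj Γ (c s + (s - τ) • v)) (deriv c s + v) -
      lagrangian H (proj Γ (c s)) (deriv c s) ≤ k s) :
    u (proj Γ (c b + (b - τ) • v)) - u (proj Γ (c a + (a - τ) • v)) -
      (u (proj Γ (c b)) - u (proj Γ (c a))) ≤ ∫ s in a..b, k s := by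
  have hne := hu.exists_nonpos hH hr hB
  have hlin : Continuous fun s : ℝ => (s - τ) • v := by fun_prop
  have hlin' : AbsolutelyContinuousOnInterval (fun s : ℝ => (s - τ) • v) a b := by
    have h1 : ContDiff ℝ 1 fun s : ℝ => (s - τ) • v := by fun_prop
    exact h1.contDiffOn.absolutelyContinuousOnInterval
  have hξ : Continuous fun s => c s + (s - τ) • v := hc.continuous.add hlin
  have hξ' : AbsolutelyContinuousOnInterval (fun s => c s + (s - τ) • v) a b :=
    (hc.absolutelyContinuous a b).add hlin'
  have h1 := hu.sub_le_integral_supportFun hH hr hB hab.le hξ hξ'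
  have h2 := hH.intervalIntegrable_supportFun hne hξ hξ'
  have h3 := hc.integrable a b hab
  rw [hc.sub_eq a b hab, sub_le_iff_le_add, ← intervalIntegral.integral_add hk h3]
  refine h1.trans (intervalIntegral.integral_mono_ae_restrict hab.le h2 (hk.add h3) ?_)
  refine (ae_restrict_iff' measurableSet_Icc).2 ?_
  filter_upwards [h, hc.ae_differentiableAt] with s hs hd hmem
  have h4 : deriv (fun s => c s + (s - τ) • v) s = deriv c s + v := by
    have h5 : HasDerivAt (fun s : ℝ => (s - τ) • v) v s := by
      simpa using ((hasDerivAt_id s).sub_const τ).smul_const v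
    exact (hd.hasDerivAt.add h5).deriv
  rw [h4]
  have := hH.supportFun_le_lagrangian (hne (proj Γ (c s + (s - τ) • v))) (deriv c s + v)
  linarith [hs hmem]

end IsCalibrated

end Calibrated

/-! ### Differentiability at Lebesgue points -/

section Differentiability

variable {N : ℕ} {Γ : AddSubgroup (Vec N)} {r : ℝ} {H : FlatSpace N Γ → Vec N → ℝ}
  {u : FlatSpace N Γ → ℝ} {c : ℝ → Vec N}

lemma ae_isLebesguePoint {f : ℝ → Vec N} (hf : LocallyIntegrable f volume) :
    ∀ᵐ t, IsLebesguePoint f t := by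
  filter_upwards [IsUnifLocDoublingMeasure.ae_tendsto_average_norm_sub volume hf 1] with t ht
  refine ⟨hf t, ?_⟩
  have h1 := ht (fun _ : ℝ => t) id (l := 𝓝[>] (0 : ℝ)) tendsto_id (by
    filter_upwards [self_mem_nhdsWithin] with ρ hρ
    exact Metric.mem_closedBall_self (by simpa using (mem_Ioi.1 hρ).le))
  refine h1.congr' ?_
  filter_upwards [self_mem_nhdsWithin] with ρ hρ
  rw [mem_Ioi] at hρ
  rw [setAverage_eq, id, Real.closedBall_eq_Icc, integral_Icc_eq_integral_Ioc,
    intervalIntegral.integral_of_le (by linarith), Real.volume_real_Icc_of_le (by linarith),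
    smul_eq_mul]
  ring_nf

/-- Convexity of `L` in the velocity and uniform continuity of `L` and `D_q L` bound the cost of
perturbing a curve, as long as it stays near `x` and its velocity stays bounded. -/
lemma IsStrictlyConvexHamiltonian.exists_lagrangian_sub_le (hH : IsStrictlyConvexHamiltonian H)
    (x : Vec N) (Q : ℝ) {ε : ℝ} (hε : 0 < ε) : ∃ δ > 0, ∃ η > 0, ∀ y w q v : Vec N,
      ‖y - x‖ ≤ η → ‖w‖ ≤ η → ‖q‖ ≤ Q → ‖v‖ = δ →
      lagrangian H (proj Γ (y + w)) (q + v) - lagrangian H (proj Γ y) q ≤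
        inner ℝ (momentum H (proj Γ y) q) v + 2 * ε * δ := by
  have hproj : Continuous fun z : Vec N × Vec N => (proj Γ z.1, z.2) :=
    (continuous_proj.comp continuous_fst).prodMk continuous_snd
  have hK := (isCompact_closedBall x 1).prod (isCompact_closedBall (0 : Vec N) (Q + 1))
  obtain ⟨δ₁, hδ₁, hD⟩ := Metric.uniformContinuousOn_iff.1
    (hK.uniformContinuousOn_of_continuous (hH.continuous_momentum.comp hproj).continuousOn) ε hε
  have hδ : 0 < min 1 (δ₁ / 2) := lt_min one_pos (half_pos hδ₁)
  set δ := min 1 (δ₁ / 2)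
  obtain ⟨η₁, hη₁, hL⟩ := Metric.uniformContinuousOn_iff.1
    (hK.uniformContinuousOn_of_continuous (hH.continuous_lagrangian.comp hproj).continuousOn)
    (ε * δ) (mul_pos hε hδ)
  have hη : 0 < min (1 / 2) (η₁ / 2) := lt_min one_half_pos (half_pos hη₁)
  refine ⟨δ, hδ, min (1 / 2) (η₁ / 2), hη, fun y w q v hy hw hq hv => ?_⟩
  set η := min (1 / 2) (η₁ / 2)
  have hη2 : η ≤ 1 / 2 := min_le_left _ _
  have hηη : η ≤ η₁ / 2 := min_le_right _ _
  have hδ1 : δ ≤ 1 := min_le_left _ _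
  have hδδ : δ ≤ δ₁ / 2 := min_le_right _ _
  have hyK : y ∈ Metric.closedBall x 1 := by
    rw [Metric.mem_closedBall, dist_eq_norm]; linarith
  have hywK : y + w ∈ Metric.closedBall x 1 := by
    rw [Metric.mem_closedBall, dist_eq_norm, add_sub_right_comm]
    linarith [norm_add_le (y - x) w]
  have hqK : q ∈ Metric.closedBall (0 : Vec N) (Q + 1) := by
    rw [mem_closedBall_zero_iff]; linarith
  have hqvK : q + v ∈ Metric.closedBall (0 : Vec N) (Q + 1) := by
    rw [mem_closedBall_zero_iff]; linarith [norm_add_le q v]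
  have h1 := hL (y + w, q + v) ⟨hywK, hqvK⟩ (y, q + v) ⟨hyK, hqvK⟩ (by
    simpa [Prod.dist_eq, dist_eq_norm, hη₁] using (by linarith : ‖w‖ < η₁))
  have h2 := hD (y, q + v) ⟨hyK, hqvK⟩ (y, q) ⟨hyK, hqK⟩ (by
    simpa [Prod.dist_eq, dist_eq_norm, hδ₁] using (by linarith : ‖v‖ < δ₁))
  simp only [Function.comp] at h1 h2
  rw [Real.dist_eq] at h1
  rw [dist_eq_norm] at h2
  have h3 := hH.lagrangian_sub_le (proj Γ y) q (q + v)
  rw [add_sub_cancel_left] at h3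
  have h4 := (real_inner_le_norm (momentum H (proj Γ y) (q + v) - momentum H (proj Γ y) q) v).trans
    (mul_le_mul_of_nonneg_right h2.le (norm_nonneg _))
  rw [inner_sub_left, hv] at h4
  linarith [(abs_lt.1 h1).2]

/-- The main estimate: one-sided bounds on the increments of `u` come from competitors that leave
the calibrated curve on `[t - h, t]`, or rejoin it on `[t, t + h]`. -/
lemma IsCalibrated.exists_eventually_abs_sub_le (hH : IsStrictlyConvexHamiltonian H)
    (hr : IsSeparated Γ r) (hB : HasC1Majorants Γ) (hu : IsSubsolution H 0 u)
    (hc : IsCalibrated H u c) {t : ℝ}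
    (ht : IsLebesguePoint (fun s => momentum H (proj Γ (c s)) (deriv c s)) t) {ε : ℝ}
    (hε : 0 < ε) : ∃ δ > 0, ∀ᶠ h in 𝓝[>] (0 : ℝ), ∀ v : Vec N, ‖v‖ = δ →
      |u (proj Γ (c t + h • v)) - u (proj Γ (c t)) -
        h * inner ℝ (momentum H (proj Γ (c t)) (deriv c t)) v| ≤ 4 * ε * (h * δ) := by
  obtain ⟨Q, hQ⟩ := hc.exists_ae_norm_deriv_le hH hr hB hu
  obtain ⟨δ, hδ, η, hη, hest⟩ := hH.exists_lagrangian_sub_le (c t) Q hε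
  have hloc := hc.locallyIntegrable_momentum hH hr hB hu
  set f := fun s => momentum H (proj Γ (c s)) (deriv c s) with hf
  have hfi : ∀ a b, IntervalIntegrable f volume a b := fun a b =>
    (hloc.integrableOn_isCompact isCompact_uIcc).intervalIntegrable
  obtain ⟨h₀, hh₀, hch⟩ := Metric.continuousAt_iff.1 hc.continuous.continuousAt η hη
  refine ⟨δ, hδ, ?_⟩
  filter_upwards [self_mem_nhdsWithin, ht.2.eventually (gt_mem_nhds hε),
    Ioo_mem_nhdsGT (lt_min hh₀ (div_pos hη hδ))] with h hh0 hleb hh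
  rw [mem_Ioi] at hh0
  have hh1 : h < h₀ := hh.2.trans_le (min_le_left _ _)
  have hh2 : h * δ < η := (lt_div_iff₀ hδ).1 (hh.2.trans_le (min_le_right _ _))
  have hleb' : ∫ s in (t - h)..(t + h), ‖f s - f t‖ ≤ 2 * h * ε := by
    rw [inv_mul_lt_iff₀ (by positivity)] at hleb
    exact hleb.le
  have hgi : ∀ a b, IntervalIntegrable (fun s => ‖f s - f t‖) volume a b := fun a b =>
    ((hfi a b).sub intervalIntegrable_const).norm
  -- the comparison on an interval of length `h` inside `[t - h, t + h]`
  have key : ∀ a b τ, b - a = h → t - h ≤ a → b ≤ t + h → τ ∈ Icc a b → ∀ v : Vec N, ‖v‖ = δ →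
      u (proj Γ (c b + (b - τ) • v)) - u (proj Γ (c a + (a - τ) • v)) -
        (u (proj Γ (c b)) - u (proj Γ (c a))) ≤ h * inner ℝ (f t) v + 4 * ε * (h * δ) := by
    intro a b τ hab ha hb hτ v hv
    have hab' : a < b := by linarith
    have hk : IntervalIntegrable (fun s => δ * ‖f s - f t‖ + (inner ℝ (f t) v + 2 * ε * δ))
        volume a b := ((hgi a b).const_mul δ).add intervalIntegrable_const
    have h1 := hc.sub_sub_le hH hr hB hu hab' τ v hk (by
      filter_upwards [hQ] with s hs hsab
      have h2 : ‖c s - c t‖ ≤ η := by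
        rw [← dist_eq_norm]
        refine (hch ?_).le
        rw [Real.dist_eq, abs_lt]
        constructor
        all_goals linarith [hsab.1, hsab.2, hτ.1, hτ.2]
      have h3 : ‖(s - τ) • v‖ ≤ η := by
        rw [norm_smul, hv, Real.norm_eq_abs]
        refine le_trans (mul_le_mul_of_nonneg_right ?_ hδ.le) hh2.le
        rw [abs_le]
        constructor <;> linarith [hsab.1, hsab.2, hτ.1, hτ.2]
      have h4 := hest (c s) ((s - τ) • v) (deriv c s) v h2 h3 hs hv
      have h5 := real_inner_le_norm (f s - f t) v
      rw [inner_sub_left, hv] at h5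
      simp only [hf] at h5 ⊢
      linarith)
    rw [intervalIntegral.integral_add ((hgi a b).const_mul δ) intervalIntegrable_const,
      intervalIntegral.integral_const, intervalIntegral.integral_const_mul, hab, smul_eq_mul] at h1
    have h6 : ∫ s in a..b, ‖f s - f t‖ ≤ ∫ s in (t - h)..(t + h), ‖f s - f t‖ :=
      intervalIntegral.integral_mono_interval ha hab'.le hb (ae_of_all _ fun _ => norm_nonneg _)
        (hgi _ _)
    have h7 := mul_le_mul_of_nonneg_left (h6.trans hleb') hδ.le
    linarith
  intro v hv
  have hup := key (t - h) t (t - h) (by ring) le_rfl (by linarith) ⟨le_rfl, by linarith⟩ v hv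
  have hlow := key t (t + h) (t + h) (by ring) (by linarith) le_rfl ⟨by linarith, le_rfl⟩ (-v)
    (by rwa [norm_neg])
  simp only [sub_self, zero_smul, add_zero, sub_sub_cancel, inner_neg_right,
    sub_add_cancel_left, neg_smul_neg] at hup hlow
  rw [abs_le]
  constructor <;> linarith

/-- A subsolution that calibrates a curve is differentiable at its points that come from Lebesgue
points of the momentum. -/
lemma IsCalibrated.hasGradAt (hH : IsStrictlyConvexHamiltonian H) (hr : IsSeparated Γ r)
    (hB : HasC1Majorants Γ) (hu : IsSubsolution H 0 u) (hc : IsCalibrated H u c) {t : ℝ}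
    (ht : IsLebesguePoint (fun s => momentum H (proj Γ (c s)) (deriv c s)) t) :
    HasGradAt u (momentum H (proj Γ (c t)) (deriv c t)) (proj Γ (c t)) := by
  rw [HasGradAt, hasGradientAt_iff_isLittleO, Asymptotics.isLittleO_iff]
  intro ε hε
  obtain ⟨δ, hδ, h⟩ := hc.exists_eventually_abs_sub_le hH hr hB hu ht (ε := ε / 4) (by positivity)
  obtain ⟨h₀, hh₀, hsub⟩ := mem_nhdsGT_iff_exists_Ioo_subset.1 h
  rw [mem_Ioi] at hh₀
  filter_upwards [Metric.ball_mem_nhds (0 : Vec N) (mul_pos hh₀ hδ)] with w hw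
  rw [mem_ball_zero_iff] at hw
  rcases eq_or_ne w 0 with rfl | hw0
  · simp
  have hw1 : 0 < ‖w‖ := norm_pos_iff.2 hw0
  -- the increment `w` is written as `h • v` with `‖v‖ = δ`
  have h1 := hsub (show ‖w‖ / δ ∈ Ioo 0 h₀ from ⟨by positivity, (div_lt_iff₀ hδ).2 hw⟩)
    ((δ / ‖w‖) • w) (by
    rw [norm_smul, Real.norm_of_nonneg (by positivity), div_mul_cancel₀ _ hw1.ne'])
  have h2 : (‖w‖ / δ) • (δ / ‖w‖) • w = w := by
    rw [smul_smul, div_mul_div_cancel₀ hδ.ne', div_self hw1.ne', one_smul]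
  rw [← real_inner_smul_right, h2, div_mul_cancel₀ _ hδ.ne'] at h1
  have h3 : proj Γ (0 : Vec N) = 0 := rfl
  rw [Real.norm_eq_abs, h3, add_zero, sub_zero, ← proj_add]
  linarith

end Differentiability

theorem mainTheorem4 (N : ℕ) (Γ : AddSubgroup (Vec N))
    (hΓ : Γ = ⊥ ∨ Γ = integerLattice N)
    (H : FlatSpace N Γ → Vec N → ℝ) (hH : IsStrictlyConvexHamiltonian H)
    (hc : IsCriticalValue H 0)
    (γ : ℝ → FlatSpace N Γ) (hγ : IsStaticCurve H γ) :
    volume (exceptionalSet H γ) = 0 ∧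
    ∀ u : FlatSpace N Γ → ℝ, IsSubsolution H 0 u →
      ∀ t₀ : ℝ, t₀ ∉ exceptionalSet H γ →
        DifferentiableAt ℝ (lagrangian H (γ t₀)) (velocity γ t₀) ∧
        HasGradAt u (lagrangianGrad H (γ t₀) (velocity γ t₀)) (γ t₀) := by
  have hr : IsSeparated Γ 1 := by
    rcases hΓ with rfl | rfl
    exacts [isSeparated_bot, isSeparated_integerLattice]
  have hB : HasC1Majorants Γ := by
    rcases hΓ with rfl | rfl
    exacts [hasC1Majorants_bot, hasC1Majorants_integerLattice]
  have hcont : Continuous γ := continuous_iff_continuousAt.2 fun t =>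
    (hγ.1 (t - 1) (t + 1)).continuousOn.continuousAt (by
      rw [uIcc_of_le (by linarith)]
      exact Icc_mem_nhds (by linarith) (by linarith))
  obtain ⟨c, hcc, hcγ⟩ := hr.exists_lift hcont
  have hvel : ∀ t, velocity γ t = deriv c t := fun t =>
    hr.velocity_eq_deriv hcc.continuousAt (Eventually.of_forall hcγ)
  have hmom : ∀ t, lagrangianGrad H (γ t) (velocity γ t) = momentum H (proj Γ (c t)) (deriv c t) :=
    fun t => by rw [hH.lagrangianGrad_eq_momentum, hvel, hcγ]
  refine ⟨?_, fun u hu t₀ ht₀ => ⟨(hH.hasGradientAt_lagrangian _ _).differentiableAt, ?_⟩⟩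
  · obtain ⟨u, hu⟩ := hc.1
    have hcal := hγ.isCalibrated hH hr hB hu hcc hcγ
    rw [measure_eq_zero_iff_ae_notMem]
    filter_upwards [hcal.ae_differentiableAt,
      ae_isLebesguePoint (hcal.locallyIntegrable_momentum hH hr hB hu)] with t hd hleb
    simp only [exceptionalSet, hmom, mem_compl_iff, not_not]
    exact ⟨⟨_, c, Eventually.of_forall hcγ, hd.hasDerivAt⟩, hleb⟩
  · have hcal := hγ.isCalibrated hH hr hB hu hcc hcγ
    simp only [exceptionalSet, hmom, mem_compl_iff, not_not] at ht₀
    rw [hmom, ← hcγ t₀]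
    exact hcal.hasGradAt hH hr hB hu ht₀.2
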